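/- **Theorem 1.** Consider finite undirected graphs $G=(V,D,L)$ with a symmetric edge set $D\subseteq V^2$ and node labels $L:V\to\mathbb{R}^n$, $n \in \mathbb{N}$. A neural network (NN) is a feed-forward network with rational weights and biases and with ReLU activation in every layer. A graph-classifier MPNN $N$ with input dimension $n$ consists of layers $l_1,\dots,l_k$, $k\ge 1$, and a readout. It computes $x_v^0=L(v)$, $x_v^i=N_i\bigl(x_v^{i-1},\sum_{(v,w)\in D}x_w^{i-1}\bigr)$ for all $v\in V$ and $1\le i\le k$, and the output $N(G)=N_r\bigl(\sum_{v\in V}x_v^k\bigr)$, where $N_1,\dots,N_k,N_r$ are NNs. Let $\Phi$ be any set of finitely described graph specifications (each $\varphi \in \Phi$ defines a set of graphs; write $G\models\varphi$ for membership) that contains at least one specification allowing graphs of arbitrary size, degree up to $4$ and natural-number labels, i.e. a $\varphi$ satisfied by every finite graph, with labels of any dimension, in which each node has at most $4$ neighbours and all label entries are natural numbers; for instance $\varphi=\mathsf{true}$. Let $\Psi_{\mathsf{eq}}$ be the set of output specifications $x_i=b$ with $b\in\mathbb{Q}$, where $y \models (x_i = b)$ means that the $i$-th entry of $y$ equals $b$.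 Then $\mathrm{ORP}_{\mathsf{graph}}(\Phi,\Psi_{\mathsf{eq}})$ is not formally verifiable: there is no algorithm that, given a graph-classifier MPNN $N$, a specification $\varphi\in\Phi$ and a specification $\psi\in\Psi_{\mathsf{eq}}$ on the output of $N$, always terminates and decides correctly whether there is a graph $G$ with $G\models\varphi$ and $N(G)\models\psi$. -/

import Mathlib

universe u

/-! ### Labelled graphs -/

/-- A finite graph whose nodes are labelled by vectors in `ℝⁿ`. The edge set is any symmetric
subset of `V × V`. -/
structure LGraph (n : ℕ) where
  V : Type
  [fin : Fintype V]
  Adj : V → V → Prop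
  symm : ∀ v w, Adj v w → Adj w v
  label : V → Fin n → ℝ

attribute [instance] LGraph.fin

namespace LGraph

open Classical in
/-- The neighbourhood of a node. -/
noncomputable def neigh {n : ℕ} (G : LGraph n) (v : G.V) : Finset G.V :=
  Finset.univ.filter (fun w => G.Adj v w)

/-- The degree of the graph is at most `d`. -/
def DegreeLE {n : ℕ} (G : LGraph n) (d : ℕ) : Prop :=
  ∀ v : G.V, (G.neigh v).card ≤ d

/-- All entries of all labels are natural numbers. -/
def NatLabelled {n : ℕ} (G : LGraph n) : Prop :=
  ∀ (v : G.V) (i : Fin n), ∃ k : ℕ, G.label v i = k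

end LGraph

/-! ### ReLU networks with rational parameters -/

/-- A fully connected layer from `ℝᵐ` to `ℝⁿ` with rational weights and biases. -/
structure ReLULayer (m n : ℕ) where
  weight : Matrix (Fin n) (Fin m) ℚ
  bias : Fin n → ℚ

/-- The function computed by a layer, `x ↦ max(0, W x + b)`. -/
noncomputable def ReLULayer.eval {m n : ℕ} (l : ReLULayer m n) (x : Fin m → ℝ) : Fin n → ℝ :=
  fun i => max 0 ((∑ j, (l.weight i j : ℝ) * x j) + (l.bias i : ℝ))

/-- A feed-forward neural network from `ℝᵐ` to `ℝⁿ`: a non-empty sequence of ReLU layers. -/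
inductive NN : ℕ → ℕ → Type
  | last {m n : ℕ} (l : ReLULayer m n) : NN m n
  | cons {m k n : ℕ} (l : ReLULayer m k) (N : NN k n) : NN m n

/-- The function computed by a neural network. -/
noncomputable def NN.eval : {m n : ℕ} → NN m n → (Fin m → ℝ) → (Fin n → ℝ)
  | _, _, .last l, x => l.eval x
  | _, _, .cons l N, x => N.eval (l.eval x)

/-! ### Graph-classifier message passing neural networks -/

/-- One message passing layer: sum aggregation over the neighbourhood, followed by a
combination network applied to the pair (own vector, aggregated vector). -/
noncomputable def mpStep {n p q : ℕ} (G : LGraph n) (comb : NN (p + p) q)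
    (x : G.V → Fin p → ℝ) : G.V → Fin q → ℝ :=
  fun v => comb.eval (Fin.append (x v) (∑ w ∈ G.neigh v, x w))

/-- A non-empty sequence of message passing layers, each given by its combination network. -/
inductive MPLayers : ℕ → ℕ → Type
  | last {m n : ℕ} (comb : NN (m + m) n) : MPLayers m n
  | cons {m k n : ℕ} (comb : NN (m + m) k) (Ls : MPLayers k n) : MPLayers m n

/-- The vectors of all nodes after the application of all message passing layers. -/
noncomputable def MPLayers.run {d : ℕ} (G : LGraph d) :
    {m n : ℕ} → MPLayers m n → (G.V → Fin m → ℝ) → (G.V → Fin n → ℝ)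
  | _, _, .last c, x => mpStep G c x
  | _, _, .cons c Ls, x => Ls.run G (mpStep G c x)

/-- A graph-classifier MPNN for graphs with labels in `ℝⁿ` and with outputs in `ℝᵒ`. -/
structure GraphMPNN (n o : ℕ) where
  hid : ℕ
  layers : MPLayers n hid
  read : NN hid o

/-- The output `N(G)`: the readout network is applied to the sum of all node vectors. -/
noncomputable def GraphMPNN.eval {n o : ℕ} (N : GraphMPNN n o) (G : LGraph n) : Fin o → ℝ :=
  N.read.eval (∑ v : G.V, N.layers.run G G.label v)

/-! ### Finite descriptions of MPNNs, the inputs of algorithms -/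

/-- Sign, absolute value of the numerator, and denominator of a rational number. -/
abbrev RatCode : Type := Bool × ℕ × ℕ

def ratCode (q : ℚ) : RatCode := (decide (q < 0), q.num.natAbs, q.den)

/-- The rows of the weight matrix, each together with its bias. -/
abbrev LayerCode : Type := List (List RatCode × RatCode)

def ReLULayer.code {m n : ℕ} (l : ReLULayer m n) : LayerCode :=
  List.ofFn fun i => (List.ofFn fun j => ratCode (l.weight i j), ratCode (l.bias i))

def NN.layerCodes : {m n : ℕ} → NN m n → List LayerCode
  | _, _, .last l => [l.code]
  | _, _, .cons l N => l.code :: N.layerCodes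

/-- The input dimension and the list of layers. -/
abbrev NNCode : Type := ℕ × List LayerCode

def NN.code {m n : ℕ} (N : NN m n) : NNCode := (m, N.layerCodes)

def MPLayers.code : {m n : ℕ} → MPLayers m n → List NNCode
  | _, _, .last c => [c.code]
  | _, _, .cons c Ls => c.code :: Ls.code

/-- The combination networks and the readout network. -/
abbrev MPNNCode : Type := List NNCode × NNCode

def GraphMPNN.code {n o : ℕ} (N : GraphMPNN n o) : MPNNCode := (N.layers.code, N.read.code)

/-! ### Specifications and output reachability properties -/

/-- Output specifications on `ℝᵒ` of the form `x_i = b` with rational `b`. -/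
structure EqSpec (o : ℕ) where
  idx : Fin o
  val : ℚ

/-- The vector `y` satisfies the specification `x_i = b`. -/
def EqSpec.Sat {o : ℕ} (ψ : EqSpec o) (y : Fin o → ℝ) : Prop := y ψ.idx = (ψ.val : ℝ)

def EqSpec.code {o : ℕ} (ψ : EqSpec o) : ℕ × RatCode := (ψ.idx, ratCode ψ.val)

/-- The language `Φ` of graph specifications, with satisfaction relation `sat`, contains a
specification that allows all graphs (of any size, and with labels of any dimension) of degree
at most `4` whose labels have natural number entries. -/
def ContainsUnbounded {Φ : Type u} (sat : Φ → ∀ n : ℕ, LGraph n → Prop) : Prop :=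
  ∃ φ : Φ, ∀ (n : ℕ) (G : LGraph n), G.DegreeLE 4 → G.NatLabelled → sat φ n G

/-- An output reachability property `(N, φ, ψ)` of a graph-classifier MPNN `N` with input
specification `φ` from `Φ` and output specification `ψ` of the form `x_i = b`. -/
structure ORPGraph (Φ : Type u) where
  inDim : ℕ
  outDim : ℕ
  net : GraphMPNN inDim outDim
  inSpec : Φ
  outSpec : EqSpec outDim

/-- The property holds: some graph satisfying `φ` is mapped to a vector satisfying `ψ`. -/
def ORPGraph.Holds {Φ : Type u} (sat : Φ → ∀ n : ℕ, LGraph n → Prop) (Q : ORPGraph Φ) : Prop :=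
  ∃ G : LGraph Q.inDim, sat Q.inSpec Q.inDim G ∧ Q.outSpec.Sat (Q.net.eval G)

/-- The description of the property that is given to an algorithm. -/
def ORPGraph.code {Φ : Type u} (Q : ORPGraph Φ) : MPNNCode × Φ × (ℕ × RatCode) :=
  (Q.net.code, Q.inSpec, Q.outSpec.code)

/-- A class `P` of safety properties, described to algorithms through `code`, is formally
verifiable: there is an algorithm that, on the description of each property of the class,
terminates and answers `true` if and only if the property holds. Nothing is required on data
that describe no property of the class. -/
def FormallyVerifiable {P C : Type u} [Primcodable C] (code : P → C) (Holds : P → Prop) : Prop :=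
  ∃ A : C →. Bool, Partrec A ∧ ∀ p : P, ∃ b ∈ A (code p), (b = true ↔ Holds p)

/-!
Halting of programs reduces to output reachability. A machine with finitely many stacks computes a
given partial recursive function, and a graph can record one of its computations: every node carries
one configuration, with the stacks read as fractions in a fixed base and multiplied by a common
power of the base. Reading, pushing and popping a symbol are then linear in the label, so that the
labels for which the configuration at a node has halted, or its successor is found at a neighbour,
form the zero set of a non-negative piecewise linear function, which a ReLU network computes.

The sum over the neighbours mixes their labels. Each record therefore occupies one of four slots of
its label, and the slots along a path rotate, so that the successor is alone in its slot. A fuel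
register that decreases along the computation excludes cycles. The readout network adds up the
violations at all nodes and compares the initial configuration with an input, which enters only
through two natural numbers in its weights.
-/

open Turing StateTransition

/-! ### Piecewise linear functions and the networks computing them -/

namespace NN

variable {m n k : ℕ}

theorem eval_nonneg (N : NN m n) (x : Fin m → ℝ) (i : Fin n) : 0 ≤ N.eval x i := by
  induction N with
  | last _ => exact le_max_left _ _
  | cons _ _ ih => exact ih _ _

/-- The network obtained by appending a layer behind the output layer. -/
def snoc : {m n k : ℕ} → NN m n → ReLULayer n k → NN m k
  | _, _, _, .last l, l' => .cons l (.last l')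
  | _, _, _, .cons l N, l' => .cons l (N.snoc l')

theorem eval_snoc (N : NN m n) (l : ReLULayer n k) (x : Fin m → ℝ) :
    (N.snoc l).eval x = l.eval (N.eval x) := by
  induction N with
  | last _ => rfl
  | cons _ _ ih => exact ih _ _

/-- The rational affine combinations of the outputs of a network: the functions that a unit of one
further layer can compute before its activation is applied. -/
noncomputable def affineSpan (N : NN m n) : Submodule ℚ ((Fin m → ℝ) → ℝ) :=
  Submodule.span ℚ (insert 1 (Set.range fun i x => N.eval x i))

theorem mem_affineSpan {N : NN m n} {f : (Fin m → ℝ) → ℝ} :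
    f ∈ N.affineSpan ↔
      ∃ (w : Fin n → ℚ) (b : ℚ), ∀ x, f x = (∑ j, (w j : ℝ) * N.eval x j) + (b : ℝ) := by
  simp only [affineSpan, Submodule.mem_span_insert, Submodule.mem_span_range_iff_exists_fun]
  constructor
  · rintro ⟨b, _, ⟨w, rfl⟩, rfl⟩
    exact ⟨w, b, fun x => by simp [Rat.smul_def, add_comm]⟩
  · rintro ⟨w, b, h⟩
    exact ⟨b, _, ⟨w, rfl⟩, funext fun x => by simp [h, Rat.smul_def, add_comm]⟩

theorem const_mem_affineSpan (N : NN m n) (q : ℚ) : (fun _ => (q : ℝ)) ∈ N.affineSpan :=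
  mem_affineSpan.2 ⟨0, q, fun x => by simp⟩

theorem eval_mem_affineSpan (N : NN m n) (i : Fin n) : (fun x => N.eval x i) ∈ N.affineSpan :=
  Submodule.subset_span (.inr ⟨i, rfl⟩)

theorem affineSpan_le {n' : ℕ} {N : NN m n} {N' : NN m n'}
    (h : ∀ i, (fun x => N.eval x i) ∈ N'.affineSpan) : N.affineSpan ≤ N'.affineSpan := by
  refine Submodule.span_le.2 (Set.insert_subset ?_ (Set.range_subset_iff.2 h))
  exact Submodule.subset_span (.inl rfl)

theorem exists_eval_eq_relu {N : NN m n} {f : Fin k → (Fin m → ℝ) → ℝ}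
    (hf : ∀ i, f i ∈ N.affineSpan) : ∃ N' : NN m k, ∀ x i, N'.eval x i = max 0 (f i x) := by
  choose w b h using fun i => mem_affineSpan.1 (hf i)
  refine ⟨N.snoc ⟨w, b⟩, fun x i => ?_⟩
  rw [eval_snoc, h]
  rfl

-- Outputs of a network are non-negative, so they pass unchanged through an additional layer.
theorem exists_relu_mem_affineSpan (N : NN m n) {f : (Fin m → ℝ) → ℝ} (hf : f ∈ N.affineSpan) :
    ∃ (n' : ℕ) (N' : NN m n'),
      N.affineSpan ≤ N'.affineSpan ∧ (fun x => max 0 (f x)) ∈ N'.affineSpan := by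
  have hall : ∀ i, Fin.cons (α := fun _ => (Fin m → ℝ) → ℝ) f (fun i x => N.eval x i) i
      ∈ N.affineSpan := Fin.cases hf N.eval_mem_affineSpan
  obtain ⟨N', h⟩ := exists_eval_eq_relu hall
  refine ⟨n + 1, N', affineSpan_le fun i => ?_, ?_⟩
  · simpa [h, N.eval_nonneg] using N'.eval_mem_affineSpan i.succ
  · simpa [h] using N'.eval_mem_affineSpan 0

-- A coordinate is recovered after the first layer as `x = max 0 x - max 0 (-x)`.
theorem exists_coord_mem_affineSpan (m : ℕ) :
    ∃ (n : ℕ) (N : NN m n), ∀ j, (fun x : Fin m → ℝ => x j) ∈ N.affineSpan := by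
  let N : NN m (m + m) :=
    .last ⟨Fin.append (fun i => Pi.single i 1) (fun i => Pi.single i (-1)), 0⟩
  have hpos : ∀ x j, N.eval x (Fin.castAdd m j) = max 0 (x j) := fun x j => by
    simp [N, NN.eval, ReLULayer.eval, Pi.single_apply, apply_ite (Rat.cast : ℚ → ℝ)]
  have hneg : ∀ x j, N.eval x (Fin.natAdd m j) = max 0 (-x j) := fun x j => by
    simp [N, NN.eval, ReLULayer.eval, -Fin.natAdd_eq_addNat, Pi.single_apply,
      apply_ite (Rat.cast : ℚ → ℝ)]
  refine ⟨m + m, N, fun j => ?_⟩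
  convert N.affineSpan.sub_mem (N.eval_mem_affineSpan (Fin.castAdd m j))
    (N.eval_mem_affineSpan (Fin.natAdd m j)) using 1
  ext x
  rw [Pi.sub_apply, hpos, hneg, max_comm, max_comm 0, max_zero_sub_eq_self]

end NN

/-- Continuous piecewise linear functions with rational coefficients, generated from the coordinates
by the operations that networks provide. -/
inductive IsPL {m : ℕ} : ((Fin m → ℝ) → ℝ) → Prop
  | coord (j : Fin m) : IsPL fun x => x j
  | const (q : ℚ) : IsPL fun _ => (q : ℝ)
  | add {f g : (Fin m → ℝ) → ℝ} : IsPL f → IsPL g → IsPL fun x => f x + g x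
  | const_mul (q : ℚ) {f : (Fin m → ℝ) → ℝ} : IsPL f → IsPL fun x => (q : ℝ) * f x
  | relu {f : (Fin m → ℝ) → ℝ} : IsPL f → IsPL fun x => max 0 (f x)

namespace IsPL

variable {m : ℕ} {f g : (Fin m → ℝ) → ℝ}

theorem exists_mem_affineSpan (hf : IsPL f) {n : ℕ} (N : NN m n)
    (hN : ∀ j, (fun x : Fin m → ℝ => x j) ∈ N.affineSpan) :
    ∃ (n' : ℕ) (N' : NN m n'), N.affineSpan ≤ N'.affineSpan ∧ f ∈ N'.affineSpan := by
  induction hf generalizing n with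
  | coord j => exact ⟨_, N, le_rfl, hN j⟩
  | const q => exact ⟨_, N, le_rfl, N.const_mem_affineSpan q⟩
  | add _ _ ihf ihg =>
    obtain ⟨n₁, N₁, h₁, hf⟩ := ihf N hN
    obtain ⟨n₂, N₂, h₂, hg⟩ := ihg N₁ fun j => h₁ (hN j)
    exact ⟨n₂, N₂, h₁.trans h₂, N₂.affineSpan.add_mem (h₂ hf) hg⟩
  | const_mul q _ ihf =>
    obtain ⟨n₁, N₁, h₁, hf⟩ := ihf N hN
    refine ⟨n₁, N₁, h₁, ?_⟩
    convert N₁.affineSpan.smul_mem q hf using 2 with x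
    exact (Rat.smul_def q _).symm
  | relu _ ihf =>
    obtain ⟨n₁, N₁, h₁, hf⟩ := ihf N hN
    obtain ⟨n₂, N₂, h₂, hr⟩ := N₁.exists_relu_mem_affineSpan hf
    exact ⟨n₂, N₂, h₁.trans h₂, hr⟩

theorem exists_NN {k : ℕ} {f : Fin k → (Fin m → ℝ) → ℝ} (hf : ∀ i, IsPL (f i)) :
    ∃ N : NN m k, ∀ x i, N.eval x i = max 0 (f i x) := by
  have hspan : ∀ s : Finset (Fin k), ∃ (n : ℕ) (N : NN m n),
      (∀ j, (fun x : Fin m → ℝ => x j) ∈ N.affineSpan) ∧ ∀ i ∈ s, f i ∈ N.affineSpan := by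
    intro s
    induction s using Finset.induction_on with
    | empty =>
      obtain ⟨n, N, hN⟩ := NN.exists_coord_mem_affineSpan m
      exact ⟨n, N, hN, by simp⟩
    | insert a s _ ih =>
      obtain ⟨n, N, hN, hs⟩ := ih
      obtain ⟨n', N', h, ha⟩ := (hf a).exists_mem_affineSpan N hN
      exact ⟨n', N', fun j => h (hN j),
        Finset.forall_mem_insert _ _ _ |>.2 ⟨ha, fun i hi => h (hs i hi)⟩⟩
  obtain ⟨n, N, -, hN⟩ := hspan Finset.univ
  exact NN.exists_eval_eq_relu fun i => hN i (Finset.mem_univ i)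

theorem natCast (n : ℕ) : IsPL (m := m) fun _ => (n : ℝ) := by
  simpa only [Rat.cast_natCast] using const (m := m) n

theorem zero : IsPL (m := m) fun _ => (0 : ℝ) := by simpa only [Nat.cast_zero] using natCast 0

theorem one : IsPL (m := m) fun _ => (1 : ℝ) := by simpa only [Nat.cast_one] using natCast 1

theorem natCast_mul (n : ℕ) (hf : IsPL f) : IsPL fun x => (n : ℝ) * f x := by
  simpa only [Rat.cast_natCast] using const_mul n hf

theorem sub (hf : IsPL f) (hg : IsPL g) : IsPL fun x => f x - g x := by
  simpa [sub_eq_add_neg] using hf.add (const_mul (-1) hg)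

theorem sum {ι : Type*} (s : Finset ι) {f : ι → (Fin m → ℝ) → ℝ} (hf : ∀ i, IsPL (f i)) :
    IsPL fun x => ∑ i ∈ s, f i x := by
  classical
  induction s using Finset.induction_on with
  | empty => simpa only [Finset.sum_empty] using zero
  | insert a s ha ih => simpa only [Finset.sum_insert ha] using (hf a).add ih

theorem min (hf : IsPL f) (hg : IsPL g) : IsPL fun x => min (f x) (g x) := by
  convert hf.sub (hf.sub hg).relu using 2 with x
  rcases le_total (f x) (g x) with h | h
  · rw [min_eq_left h, max_eq_left (sub_nonpos.2 h), sub_zero]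
  · rw [min_eq_right h, max_eq_right (sub_nonneg.2 h), sub_sub_cancel]

end IsPL

/-- Predicates that define the zero set of a non-negative piecewise linear function: the conditions
that a network can check. -/
def IsPLPred {m : ℕ} (P : (Fin m → ℝ) → Prop) : Prop :=
  ∃ f : (Fin m → ℝ) → ℝ, IsPL f ∧ (∀ x, 0 ≤ f x) ∧ ∀ x, f x = 0 ↔ P x

namespace IsPLPred

variable {m : ℕ} {P Q : (Fin m → ℝ) → Prop} {f g : (Fin m → ℝ) → ℝ}

theorem and (hP : IsPLPred P) (hQ : IsPLPred Q) : IsPLPred fun x => P x ∧ Q x := by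
  obtain ⟨f, hf, f0, hfP⟩ := hP
  obtain ⟨g, hg, g0, hgQ⟩ := hQ
  refine ⟨_, hf.add hg, fun x => add_nonneg (f0 x) (g0 x), fun x => ?_⟩
  rw [add_eq_zero_iff_of_nonneg (f0 x) (g0 x), hfP, hgQ]

theorem or (hP : IsPLPred P) (hQ : IsPLPred Q) : IsPLPred fun x => P x ∨ Q x := by
  obtain ⟨f, hf, f0, hfP⟩ := hP
  obtain ⟨g, hg, g0, hgQ⟩ := hQ
  refine ⟨_, hf.min hg, fun x => le_min (f0 x) (g0 x), fun x => ?_⟩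
  simp only [← hfP, ← hgQ]
  grind

theorem le (hf : IsPL f) (hg : IsPL g) : IsPLPred fun x => f x ≤ g x :=
  ⟨_, (hf.sub hg).relu, fun _ => le_max_left _ _, fun _ => by rw [max_eq_left_iff, sub_nonpos]⟩

theorem eq (hf : IsPL f) (hg : IsPL g) : IsPLPred fun x => f x = g x := by
  simpa only [le_antisymm_iff] using (le hf hg).and (le hg hf)

theorem const (p : Prop) : IsPLPred (m := m) fun _ => p := by
  by_cases hp : p
  · exact ⟨_, IsPL.zero, fun _ => le_rfl, fun _ => by simp [hp]⟩
  · exact ⟨_, IsPL.one, fun _ => zero_le_one, fun _ => by simp [hp]⟩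

theorem imp {p : Prop} (hP : IsPLPred P) : IsPLPred fun x => p → P x := by
  by_cases hp : p
  · simpa [hp] using hP
  · simpa [hp] using const True

end IsPLPred

theorem IsPLPred.forall {m : ℕ} {ι : Type*} [Finite ι] {P : ι → (Fin m → ℝ) → Prop}
    (hP : ∀ i, IsPLPred (P i)) : IsPLPred fun x => ∀ i, P i x := by
  cases nonempty_fintype ι
  choose f hf f0 hfP using hP
  refine ⟨_, IsPL.sum Finset.univ hf, fun x => Finset.sum_nonneg fun i _ => f0 i x, fun x => ?_⟩
  simp only [Finset.sum_eq_zero_iff_of_nonneg fun i _ => f0 i x, Finset.mem_univ, true_imp_iff, hfP]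

theorem IsPLPred.exists_mem {m : ℕ} {ι : Type*} (s : Finset ι) {P : ι → (Fin m → ℝ) → Prop}
    (hP : ∀ i, IsPLPred (P i)) : IsPLPred fun x => ∃ i ∈ s, P i x := by
  classical
  induction s using Finset.induction_on with
  | empty => simpa using const False
  | insert a s _ ih => simpa only [Finset.exists_mem_insert] using (hP a).or ih

theorem IsPLPred.exists {m : ℕ} {ι : Type*} [Finite ι] {P : ι → (Fin m → ℝ) → Prop}
    (hP : ∀ i, IsPLPred (P i)) : IsPLPred fun x => ∃ i, P i x := by
  cases nonempty_fintype ι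
  simpa using exists_mem Finset.univ hP

theorem IsPLPred.exists_NN {m k : ℕ} {P : (Fin m → ℝ) → Prop} (hP : IsPLPred P)
    {g : Fin k → (Fin m → ℝ) → ℝ} (hg : ∀ i, IsPL (g i)) :
    ∃ N : NN m (k + 1), (∀ x, N.eval x 0 = 0 ↔ P x) ∧
      ∀ x i, N.eval x (Fin.succ i) = max 0 (g i x) := by
  obtain ⟨f, hf, f0, hfP⟩ := hP
  have hall : ∀ i, IsPL (Fin.cons (α := fun _ => (Fin m → ℝ) → ℝ) f g i) := Fin.cases hf hg
  obtain ⟨N, hN⟩ := IsPL.exists_NN hall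
  exact ⟨N, fun x => by simpa [hN, f0 x] using hfP x, fun x i => by simp [hN]⟩

/-! ### Stacks as real numbers -/

section Stacks

variable {Γ : Type*} [Fintype Γ]

variable (Γ) in
/-- The base of the positional notation in which stacks over the alphabet `Γ` are written. It is
twice the number of symbols, so that only odd digits are needed. -/
def base : ℕ := 2 * Fintype.card Γ

/-- The digit of a symbol. Digits are odd, so that the symbol on top of a stack is separated from
every other one by a gap and can be found by non-strict inequalities. -/
noncomputable def digit (a : Γ) : ℕ := 2 * (Fintype.equivFin Γ a : ℕ) + 1

/-- The stack `a₁, a₂, …`, with `a₁` on top, as the number `0.d₁d₂…` in base `base Γ`. -/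
noncomputable def stackVal : List Γ → ℝ
  | [] => 0
  | a :: l => (base Γ : ℝ)⁻¹ * (digit a + stackVal l)

/-- The digits of a stack `a₁, …, aₙ` as the natural number `d₁…dₙ` in base `base Γ`. -/
noncomputable def stackNum : List Γ → ℕ
  | [] => 0
  | a :: l => digit a * base Γ ^ l.length + stackNum l

theorem digit_add_one_le_base (a : Γ) : digit a + 1 ≤ base Γ := by
  have := (Fintype.equivFin Γ a).isLt
  simp only [digit, base]
  lia

theorem base_pos (a : Γ) : 0 < base Γ := (Nat.succ_pos _).trans_le (digit_add_one_le_base a)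

theorem eq_of_digit_le {a b : Γ} (hab : digit a ≤ digit b + 1) (hba : digit b ≤ digit a + 1) :
    a = b := by
  apply (Fintype.equivFin Γ).injective
  simp only [digit] at hab hba
  lia

theorem stackVal_mem_Icc (l : List Γ) : stackVal l ∈ Set.Icc (0 : ℝ) 1 := by
  induction l with
  | nil => simp [stackVal]
  | cons a l ih =>
    have hb : (0 : ℝ) < base Γ := mod_cast base_pos a
    have hd : (digit a + 1 : ℝ) ≤ base Γ := mod_cast digit_add_one_le_base a
    rw [stackVal, Set.mem_Icc, inv_mul_le_iff₀ hb]
    exact ⟨by have := ih.1; positivity, by linarith [ih.2]⟩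

theorem base_mul_stackVal_cons (a : Γ) (l : List Γ) :
    base Γ * stackVal (a :: l) = digit a + stackVal l :=
  mul_inv_cancel_left₀ (mod_cast (base_pos a).ne') _

theorem base_pow_length_mul_stackVal (l : List Γ) :
    base Γ ^ l.length * stackVal l = stackNum l := by
  induction l with
  | nil => simp [stackVal, stackNum]
  | cons a l ih =>
    rw [List.length_cons, pow_succ, mul_assoc, base_mul_stackVal_cons, mul_add, ih, stackNum]
    push_cast
    ring

theorem base_pow_length_mul_eq_iff {κ s : ℝ} (l : List Γ) :
    base Γ ^ l.length * s = stackNum l * κ ↔ s = κ * stackVal l := by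
  have hpos : (base Γ : ℝ) ^ l.length ≠ 0 := by
    cases l with
    | nil => simp
    | cons a l => exact pow_ne_zero _ (mod_cast (base_pos a).ne')
  rw [← base_pow_length_mul_stackVal, mul_assoc, mul_right_inj' hpos, mul_comm κ]

theorem base_pow_mul_stackVal {l : List Γ} {h : ℕ} (hl : l.length ≤ h) :
    base Γ ^ h * stackVal l = (base Γ ^ (h - l.length) * stackNum l : ℕ) := by
  rw [Nat.cast_mul, ← base_pow_length_mul_stackVal, Nat.cast_pow, ← mul_assoc, ← pow_add,
    Nat.sub_add_cancel hl]

/-- `HasTop κ s t` says that `t` is the symbol on top of the stack with value `s / κ`, where `none`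
stands for the empty stack. It is a system of linear inequalities in `κ` and `s`. -/
def HasTop (κ s : ℝ) : Option Γ → Prop
  | none => s = 0
  | some a => digit a * κ ≤ base Γ * s ∧ base Γ * s ≤ (digit a + 1 : ℕ) * κ

/-- The value, scaled by `κ`, of a stack after `a` is pushed. -/
noncomputable def pushVal (κ : ℝ) (a : Γ) (s : ℝ) : ℝ := (base Γ : ℝ)⁻¹ * (digit a * κ + s)

/-- The value, scaled by `κ`, of a stack after its top symbol, if it has one, is removed. -/
noncomputable def popVal (κ : ℝ) (s : ℝ) : Option Γ → ℝ
  | none => s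
  | some a => base Γ * s - digit a * κ

theorem pushVal_stackVal (κ : ℝ) (a : Γ) (l : List Γ) :
    pushVal κ a (κ * stackVal l) = κ * stackVal (a :: l) := by
  rw [pushVal, stackVal]
  ring

theorem popVal_stackVal (κ : ℝ) (l : List Γ) :
    popVal κ (κ * stackVal l) l.head? = κ * stackVal l.tail := by
  cases l with
  | nil => rfl
  | cons a l =>
    rw [List.head?_cons, List.tail_cons, popVal, mul_left_comm, base_mul_stackVal_cons]
    ring

theorem hasTop_mul_iff {κ : ℝ} (hκ : 0 < κ) (s : ℝ) (t : Option Γ) :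
    HasTop κ (κ * s) t ↔ HasTop 1 s t := by
  cases t with
  | none => simp only [HasTop, mul_eq_zero, hκ.ne', false_or]
  | some a =>
    simp only [HasTop, mul_left_comm _ κ, mul_comm _ κ, mul_le_mul_iff_right₀ hκ,
      mul_one]

theorem hasTop_one_stackVal_iff (l : List Γ) (t : Option Γ) :
    HasTop 1 (stackVal l) t ↔ t = l.head? := by
  rcases l with _ | ⟨a, l⟩ <;> rcases t with _ | b
  · simp [HasTop, stackVal]
  · have : (0 : ℝ) < 2 * (Fintype.equivFin Γ b : ℕ) + 1 := by positivity
    simp [HasTop, stackVal, digit, this]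
  · have := (stackVal_mem_Icc l).1
    have hpos : 0 < (base Γ : ℝ) * stackVal (a :: l) := by
      rw [base_mul_stackVal_cons, digit]
      positivity
    simpa [HasTop] using (pos_of_mul_pos_right hpos (Nat.cast_nonneg _)).ne'
  · obtain ⟨h0, h1⟩ := stackVal_mem_Icc l
    simp only [HasTop, base_mul_stackVal_cons, mul_one, List.head?_cons, Option.some_inj]
    constructor
    · rintro ⟨hb, ha⟩
      have hba : (digit b : ℝ) ≤ (digit a + 1 : ℕ) := by push_cast; linarith
      have hab : (digit a : ℝ) ≤ (digit b + 1 : ℕ) := by linarith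
      exact eq_of_digit_le (mod_cast hba) (mod_cast hab)
    · rintro rfl
      push_cast
      exact ⟨by linarith, by linarith⟩

theorem hasTop_mul_stackVal_iff {κ : ℝ} (hκ : 0 < κ) (l : List Γ) (t : Option Γ) :
    HasTop κ (κ * stackVal l) t ↔ t = l.head? :=
  (hasTop_mul_iff hκ _ t).trans (hasTop_one_stackVal_iff l t)

end Stacks

/-! ### Steps of a stack machine -/

section Machines

variable {K Γ Λ σ : Type*} [DecidableEq K] [Fintype Γ]

/-- The weakest precondition of the postcondition `post` under the execution of a statement, in
terms of the values of the stacks, scaled by `κ`. The postcondition speaks about the next label, the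
internal state and the stacks. -/
def stmtWP (κ : ℝ) (post : Option Λ → σ → (K → ℝ) → Prop) :
    TM2.Stmt (fun _ : K => Γ) Λ σ → σ → (K → ℝ) → Prop
  | .push k f q, v, s => stmtWP κ post q v (Function.update s k (pushVal κ (f v) (s k)))
  | .peek k f q, v, s => ∃ t : Option Γ, HasTop κ (s k) t ∧ stmtWP κ post q (f v t) s
  | .pop k f q, v, s => ∃ t : Option Γ, HasTop κ (s k) t ∧
      stmtWP κ post q (f v t) (Function.update s k (popVal κ (s k) t))
  | .load f q, v, s => stmtWP κ post q (f v) s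
  | .branch p q₁ q₂, v, s => cond (p v) (stmtWP κ post q₁ v s) (stmtWP κ post q₂ v s)
  | .goto f, v, s => post (some (f v)) v s
  | .halt, v, s => post none v s

theorem stmtWP_iff {κ : ℝ} (hκ : 0 < κ) (post : Option Λ → σ → (K → ℝ) → Prop)
    (q : TM2.Stmt (fun _ : K => Γ) Λ σ) (v : σ) (S : K → List Γ) :
    stmtWP κ post q v (fun k => κ * stackVal (S k)) ↔
      post (TM2.stepAux q v S).l (TM2.stepAux q v S).var
        fun k => κ * stackVal ((TM2.stepAux q v S).stk k) := by
  have hupdate (S : K → List Γ) (k : K) (l : List Γ) :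
      Function.update (fun k => κ * stackVal (S k)) k (κ * stackVal l) =
        fun j => κ * stackVal (Function.update S k l j) := by
    ext j
    rcases eq_or_ne j k with rfl | h <;> simp [*]
  induction q generalizing v S with
  | push k f q ih => rw [stmtWP, pushVal_stackVal, hupdate]; exact ih _ _
  | peek k f q ih => simp only [stmtWP, hasTop_mul_stackVal_iff hκ, exists_eq_left, ih]; rfl
  | pop k f q ih =>
    simp only [stmtWP, hasTop_mul_stackVal_iff hκ, exists_eq_left, popVal_stackVal, hupdate, ih]
    rfl
  | load f _ ih => exact ih (f v) S
  | branch p q₁ q₂ ih₁ ih₂ => cases hp : p v <;> simp [stmtWP, TM2.stepAux, hp, ih₁, ih₂]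
  | goto f => rfl
  | halt => rfl

theorem IsPLPred.hasTop {m : ℕ} {κ s : (Fin m → ℝ) → ℝ} (hκ : IsPL κ) (hs : IsPL s) :
    ∀ t : Option Γ, IsPLPred fun x => HasTop (κ x) (s x) t
  | none => .eq hs .zero
  | some _ => .and (.le (hκ.natCast_mul _) (hs.natCast_mul _))
      (.le (hs.natCast_mul _) (hκ.natCast_mul _))

theorem IsPL.pushVal {m : ℕ} {κ s : (Fin m → ℝ) → ℝ} (hκ : IsPL κ) (hs : IsPL s) (a : Γ) :
    IsPL fun x => pushVal (κ x) a (s x) := by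
  simpa [_root_.pushVal] using ((hκ.natCast_mul (digit a)).add hs).const_mul (base Γ : ℚ)⁻¹

theorem IsPL.popVal {m : ℕ} {κ s : (Fin m → ℝ) → ℝ} (hκ : IsPL κ) (hs : IsPL s) :
    ∀ t : Option Γ, IsPL fun x => popVal (κ x) (s x) t
  | none => hs
  | some _ => (hs.natCast_mul _).sub (hκ.natCast_mul _)

theorem IsPL.update {m : ℕ} {s : (Fin m → ℝ) → K → ℝ} {f : (Fin m → ℝ) → ℝ}
    (hs : ∀ k, IsPL fun x => s x k) (hf : IsPL f) (k j : K) :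
    IsPL fun x => Function.update (s x) k (f x) j := by
  rcases eq_or_ne j k with rfl | h
  · simpa only [Function.update_self] using hf
  · simpa only [Function.update_of_ne h] using hs j

theorem IsPLPred.stmtWP {m : ℕ} {κ : (Fin m → ℝ) → ℝ} (hκ : IsPL κ)
    {post : (Fin m → ℝ) → Option Λ → σ → (K → ℝ) → Prop}
    (hpost : ∀ l v (s : (Fin m → ℝ) → K → ℝ), (∀ k, IsPL fun x => s x k) →
      IsPLPred fun x => post x l v (s x))
    (q : TM2.Stmt (fun _ : K => Γ) Λ σ) (v : σ) (s : (Fin m → ℝ) → K → ℝ)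
    (hs : ∀ k, IsPL fun x => s x k) : IsPLPred fun x => stmtWP (κ x) (post x) q v (s x) := by
  induction q generalizing v s with
  | push k f _ ih => exact ih _ _ (IsPL.update hs (hκ.pushVal (hs k) (f v)) k)
  | peek k f q ih => exact .exists fun t => (hasTop hκ (hs k) t).and (ih _ _ hs)
  | pop k f q ih =>
    exact .exists fun t => (hasTop hκ (hs k) t).and
      (ih _ _ (IsPL.update hs (hκ.popVal (hs k) t) k))
  | load f _ ih => exact ih _ _ hs
  | branch p q₁ q₂ ih₁ ih₂ =>
    cases hp : p v
    · simpa only [_root_.stmtWP, hp, cond_false] using ih₂ v s hs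
    · simpa only [_root_.stmtWP, hp, cond_true] using ih₁ v s hs
  | goto f => exact hpost _ _ _ hs
  | halt => exact hpost _ _ _ hs

end Machines

/-! ### Records of computations in labelled graphs -/

/-- The registers of a record of a configuration of a stack machine with stacks `K`. -/
inductive Register (K : Type*)
  | present
  | fuel
  | state
  | scale
  | stack (k : K)
  deriving Fintype

/-- The slots in which a node can store its record: a sum of labels keeps records in different slots
apart. The slot `none` is that of the start of a computation; later ones rotate in the three others,
so that the two neighbours of a node on a path use different slots. -/
abbrev Slot : Type := Option (Fin 3)

/-- The slot of the successor of a record. -/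
def Slot.next : Slot → Slot
  | none => some 0
  | some i => some (i + 1)

theorem Slot.next_ne_none (t : Slot) : t.next ≠ none := by cases t <;> simp [next]

theorem Slot.next_next_ne : ∀ t : Slot, t.next.next ≠ t := by decide

section Condition

variable {K Γ Λ σ : Type*} [Fintype Γ]

/-- The record `x` represents the configuration `c`, with labels and internal states numbered by
`code`: a stack is stored as its value times the scale, which clears all denominators. -/
def Represents (code : Option Λ × σ → ℕ) (x : Register K → ℝ)
    (c : TM2.Cfg (fun _ : K => Γ) Λ σ) : Prop :=
  x .state = code (c.l, c.var) ∧ ∀ k, x (.stack k) = x .scale * stackVal (c.stk k)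

/-- The record `x` is that of a halted configuration. -/
def IsHalted (code : Option Λ × σ → ℕ) (x : Register K → ℝ) : Prop :=
  ∃ v, x .state = code (none, v)

/-- The record `x` is that of an initial configuration, with an unspecified input on the stack `k₀`
and all other stacks empty. -/
def IsInitial [Inhabited Λ] [Inhabited σ] (code : Option Λ × σ → ℕ) (k₀ : K)
    (x : Register K → ℝ) : Prop :=
  x .state = code (some default, default) ∧ 1 ≤ x .scale ∧ 0 ≤ x (.stack k₀) ∧
    ∀ k, k ≠ k₀ → x (.stack k) = 0

/-- The record `y` results from the record `x` by one step of the machine `M`. The fuel decreases,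
which excludes infinite computations along cycles. -/
def IsSuccessor [DecidableEq K] (M : Λ → TM2.Stmt (fun _ : K => Γ) Λ σ) (S : Finset Λ)
    (code : Option Λ × σ → ℕ) (x y : Register K → ℝ) : Prop :=
  y .fuel + 1 ≤ x .fuel ∧ y .scale = x .scale ∧ ∃ l ∈ S, ∃ v, x .state = code (some l, v) ∧
    stmtWP (x .scale) (fun l' v' s => y .state = code (l', v') ∧ ∀ k, y (.stack k) = s k)
      (M l) v fun k => x (.stack k)

variable {M : Λ → TM2.Stmt (fun _ : K => Γ) Λ σ} {S : Finset Λ} {code : Option Λ × σ → ℕ}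
  {x y : Register K → ℝ} {c : TM2.Cfg (fun _ : K => Γ) Λ σ}

/-- The numbering `code` distinguishes all pairs of an internal state and a label that is `none` or
belongs to `S`. -/
def Separates (S : Finset Λ) (code : Option Λ × σ → ℕ) : Prop :=
  Set.InjOn code {p | p.1 ∈ Finset.insertNone S}

theorem exists_separates [Finite σ] (S : Finset Λ) :
    ∃ code : Option Λ × σ → ℕ, Separates S code := by
  refine Set.countable_iff_exists_injOn.1 (Set.Finite.countable ?_)
  exact (Finset.finite_toSet _).prod Set.finite_univ |>.subset fun p hp => ⟨hp, trivial⟩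

theorem Represents.state_eq_iff (hcode : Separates S code) (hc : c.l ∈ Finset.insertNone S)
    (h : Represents code x c) {l : Option Λ} (hl : l ∈ Finset.insertNone S) (v : σ) :
    x .state = code (l, v) ↔ c.l = l ∧ c.var = v := by
  rw [h.1, Nat.cast_inj, hcode.eq_iff hc hl, Prod.mk_inj]

variable [DecidableEq K]

theorem Represents.isHalted_iff (hcode : Separates S code) (hc : c.l ∈ Finset.insertNone S)
    (h : Represents code x c) : IsHalted code x ↔ TM2.step M c = none := by
  simp only [IsHalted, h.state_eq_iff hcode hc (Finset.none_mem_insertNone), exists_and_left,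
    exists_eq', and_true]
  rcases c with ⟨_ | l, v, T⟩ <;> simp [TM2.step]

theorem Represents.stmtWP_iff (h : Represents code x c) (hscale : 0 < x .scale)
    (post : Option Λ → σ → (K → ℝ) → Prop) (l : Λ) (v : σ) :
    stmtWP (x .scale) post (M l) v (fun k => x (.stack k)) ↔
      post (TM2.stepAux (M l) v c.stk).l (TM2.stepAux (M l) v c.stk).var
        fun k => x .scale * stackVal ((TM2.stepAux (M l) v c.stk).stk k) := by
  simp only [h.2, _root_.stmtWP_iff hscale]

theorem Represents.isSuccessor_iff (hcode : Separates S code) (hc : c.l ∈ Finset.insertNone S)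
    (h : Represents code x c) (hscale : 0 < x .scale) :
    IsSuccessor M S code x y ↔ y .fuel + 1 ≤ x .fuel ∧ y .scale = x .scale ∧
      ∃ c' ∈ TM2.step M c, Represents code y c' := by
  refine and_congr_right fun _ => and_congr_right fun hy => ?_
  simp only [h.stmtWP_iff hscale]
  rw [← hy]
  constructor
  · rintro ⟨l, hl, v, hx, hwp⟩
    obtain ⟨hcl, rfl⟩ := (h.state_eq_iff hcode hc (Finset.some_mem_insertNone.2 hl) v).1 hx
    refine ⟨_, ?_, hwp⟩
    rcases c with ⟨_, v, T⟩
    cases hcl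
    rfl
  · rintro ⟨c', hc', hy'⟩
    rcases c with ⟨_ | l, v, T⟩
    · cases hc'
    · cases hc'
      exact ⟨l, Finset.some_mem_insertNone.1 hc, v, h.1, hy'⟩

theorem eval_dom_of_represents [Inhabited Λ] (hM : TM2.Supports M S) (hcode : Separates S code)
    {ι : Type*} {x : ι → Register K → ℝ} (hfuel : ∀ i, 0 ≤ x i .fuel)
    (hstep : ∀ i, IsHalted code (x i) ∨ ∃ j, IsSuccessor M S code (x i) (x j))
    {i : ι} (hc : c.l ∈ Finset.insertNone S) (h : Represents code (x i) c)
    (hscale : 0 < x i .scale) : (eval (TM2.step M) c).Dom := by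
  suffices ∀ (n : ℕ) (i c), x i .fuel < n → c.l ∈ Finset.insertNone S → Represents code (x i) c →
      0 < x i .scale → (eval (TM2.step M) c).Dom by
    obtain ⟨n, hn⟩ := exists_nat_gt (x i .fuel)
    exact this n i c hn hc h hscale
  intro n
  induction n with
  | zero => exact fun i c hn => absurd hn (by simpa using hfuel i)
  | succ n ih =>
    intro i c hn hc h hscale
    rcases hstep i with hi | ⟨j, hj⟩
    · exact Part.dom_iff_mem.2 ⟨c, mem_eval.2 ⟨.refl, (h.isHalted_iff hcode hc).1 hi⟩⟩
    · obtain ⟨hlt, hsc, c', hc', h'⟩ := (h.isSuccessor_iff hcode hc hscale).1 hj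
      have hn' : x j .fuel < n := by push_cast at hn; linarith
      rw [reaches_eval (.single hc')]
      exact ih j c' hn' (TM2.step_supports M hM hc' hc) h' (hsc ▸ hscale)

theorem represents_init_iff [Inhabited Λ] [Inhabited σ] (k₀ : K) (L : List Γ) :
    1 ≤ x .scale ∧ Represents code x (TM2.init k₀ L) ↔ IsInitial code k₀ x ∧
      base Γ ^ L.length * x (.stack k₀) = stackNum L * x .scale := by
  have hstacks : (∀ k, x (.stack k) = x .scale * stackVal (Function.update (fun _ => []) k₀ L k)) ↔
      x (.stack k₀) = x .scale * stackVal L ∧ ∀ k, k ≠ k₀ → x (.stack k) = 0 := by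
    constructor
    · exact fun h => ⟨by simpa using h k₀, fun k hk => by simpa [hk, stackVal] using h k⟩
    · rintro ⟨h₀, h⟩ k
      rcases eq_or_ne k k₀ with rfl | hk
      · simpa using h₀
      · simpa [hk, stackVal] using h k hk
  have hnonneg : 1 ≤ x .scale → 0 ≤ x .scale * stackVal L := fun h =>
    mul_nonneg (zero_le_one.trans h) (stackVal_mem_Icc L).1
  simp only [Represents, TM2.init, IsInitial, base_pow_length_mul_eq_iff, hstacks]
  constructor
  · rintro ⟨hscale, hstate, h₀, hk⟩
    exact ⟨⟨hstate, hscale, h₀ ▸ hnonneg hscale, hk⟩, h₀⟩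
  · rintro ⟨⟨hstate, hscale, -, hk⟩, h₀⟩
    exact ⟨hscale, hstate, h₀, hk⟩

end Condition

/-! ### Local validity of labelled graphs -/

/-- The dimension of labels that have room for a record in each slot. -/
abbrev labelDim (K : Type*) [Fintype K] : ℕ := Fintype.card (Slot × Register K)

/-- The contents of the slots of a label, or of a sum of labels. -/
noncomputable def slots (K : Type*) [Fintype K] :
    (Fin (labelDim K) → ℝ) ≃ₗ[ℝ] (Slot → Register K → ℝ) :=
  LinearEquiv.funCongrLeft ℝ ℝ (Fintype.equivFin _) ≪≫ₗ LinearEquiv.curry ℝ ℝ Slot (Register K)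

section LocalValidity

variable {K Γ Λ σ : Type*} [Fintype Γ] {M : Λ → TM2.Stmt (fun _ : K => Γ) Λ σ}
  {S : Finset Λ} {code : Option Λ × σ → ℕ}

theorem IsPLPred.isSuccessor [Finite K] [DecidableEq K] [Finite σ] {m : ℕ}
    {x y : (Fin m → ℝ) → Register K → ℝ} (hx : ∀ r, IsPL fun z => x z r)
    (hy : ∀ r, IsPL fun z => y z r) :
    IsPLPred fun z => IsSuccessor M S code (x z) (y z) :=
  .and (.le ((hy _).add .one) (hx _)) <| .and (.eq (hy _) (hx _)) <| .exists_mem S fun _ =>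
    .exists fun _ => .and (.eq (hx _) (.natCast _)) <| .stmtWP (hx _)
      (fun _ _ _ hs => .and (.eq (hy _) (.natCast _)) (.forall fun k => .eq (hy _) (hs k)))
      _ _ _ fun _ => hx _

variable [Inhabited Λ] [Inhabited σ] {k₀ : K}

theorem IsPLPred.isInitial [Finite K] {m : ℕ} {x : (Fin m → ℝ) → Register K → ℝ}
    (hx : ∀ r, IsPL fun z => x z r) : IsPLPred fun z => IsInitial code k₀ (x z) :=
  .and (.eq (hx _) (.natCast _)) <| .and (.le .one (hx _)) <| .and (.le .zero (hx _)) <|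
    .forall fun _ => .imp (.eq (hx _) .zero)

variable [DecidableEq K]

/-- The condition on a node with a record in slot `t`, in terms of its own slots and the sum `nb` of
the slots of its neighbours. When the slot `t.next` of `nb` has presence `1`, it contains the record
of a single neighbour. -/
structure LocallyValid (M : Λ → TM2.Stmt (fun _ : K => Γ) Λ σ) (S : Finset Λ)
    (code : Option Λ × σ → ℕ) (k₀ : K) (t : Slot) (own nb : Slot → Register K → ℝ) : Prop where
  eq_zero : ∀ s, s ≠ t → ∀ r, own s r = 0
  present : own t .present = 1
  fuel_nonneg : 0 ≤ own t .fuel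
  initial : t = none → IsInitial code k₀ (own t)
  step : IsHalted code (own t) ∨
    nb t.next .present = 1 ∧ IsSuccessor M S code (own t) (nb t.next)

theorem IsPLPred.locallyValid [Finite K] [Finite σ] {m : ℕ}
    {own nb : (Fin m → ℝ) → Slot → Register K → ℝ} (hown : ∀ t r, IsPL fun x => own x t r)
    (hnb : ∀ t r, IsPL fun x => nb x t r) (t : Slot) :
    IsPLPred fun x => LocallyValid M S code k₀ t (own x) (nb x) := by
  cases nonempty_fintype K
  have hconj : IsPLPred fun x => (∀ s, s ≠ t → ∀ r, own x s r = 0) ∧ own x t .present = 1 ∧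
      0 ≤ own x t .fuel ∧ (t = none → IsInitial code k₀ (own x t)) ∧
      (IsHalted code (own x t) ∨
        nb x t.next .present = 1 ∧ IsSuccessor M S code (own x t) (nb x t.next)) :=
    .and (.forall fun s => .imp (.forall fun r => .eq (hown s r) .zero)) <|
      .and (.eq (hown t _) .one) <| .and (.le .zero (hown t _)) <|
      .and (.imp (.isInitial (hown t))) <| .or (.exists fun _ => .eq (hown t _) (.natCast _)) <|
      .and (.eq (hnb _ _) .one) (.isSuccessor (hown t) (hnb _))
  convert hconj using 2
  exact ⟨fun ⟨h₁, h₂, h₃, h₄, h₅⟩ => ⟨h₁, h₂, h₃, h₄, h₅⟩,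
    fun ⟨h₁, h₂, h₃, h₄, h₅⟩ => ⟨h₁, h₂, h₃, h₄, h₅⟩⟩

theorem exists_sum_slot_eq {ι T R : Type*} {s : Finset ι} {y : ι → T → R → ℝ} {sl : ι → T}
    (hzero : ∀ i t, t ≠ sl i → ∀ r, y i t r = 0) {r₀ : R} (hone : ∀ i, y i (sl i) r₀ = 1)
    {t : T} (ht : ∑ i ∈ s, y i t r₀ = 1) :
    ∃ i, sl i = t ∧ ∀ r, ∑ j ∈ s, y j t r = y i t r := by
  classical
  have hsum (r : R) : ∑ j ∈ s, y j t r = ∑ j ∈ s with sl j = t, y j t r :=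
    (Finset.sum_filter_of_ne fun j _ hj => by_contra fun h => hj (hzero j t (Ne.symm h) r)).symm
  have hcard : (s.filter (sl · = t)).card = 1 := by
    have hterm : ∀ j ∈ s.filter (sl · = t), y j t r₀ = 1 := fun j hj =>
      (Finset.mem_filter.1 hj).2 ▸ hone j
    rw [hsum, Finset.sum_congr rfl hterm, Finset.sum_const, nsmul_one] at ht
    exact mod_cast ht
  obtain ⟨i, hi⟩ := Finset.card_eq_one.1 hcard
  have hmem : i ∈ s.filter (sl · = t) := hi ▸ Finset.mem_singleton_self i
  refine ⟨i, (Finset.mem_filter.1 hmem).2, fun r => ?_⟩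
  rw [hsum, hi, Finset.sum_singleton]

variable [Fintype K] {G : LGraph (labelDim K)} {sl : G.V → Slot}

theorem LocallyValid.isHalted_or_exists_isSuccessor (hG : ∀ v, LocallyValid M S code k₀ (sl v)
      (slots K (G.label v)) (slots K (∑ w ∈ G.neigh v, G.label w))) (v : G.V) :
    IsHalted code (slots K (G.label v) (sl v)) ∨ ∃ w,
      IsSuccessor M S code (slots K (G.label v) (sl v)) (slots K (G.label w) (sl w)) := by
  refine (hG v).step.imp_right fun ⟨hpresent, hsucc⟩ => ?_
  simp only [map_sum, Finset.sum_apply] at hpresent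
  obtain ⟨w, hw, hsum⟩ := exists_sum_slot_eq (fun w => (hG w).eq_zero) (fun w => (hG w).present)
    hpresent
  refine ⟨w, ?_⟩
  convert hsucc using 1
  ext r
  rw [map_sum, Finset.sum_apply, Finset.sum_apply, hsum, hw]

variable (M S code k₀) in
/-- The graph `G` records a halting computation of `M` on the input `L`: the node in slot `none`,
which is unique, holds the initial configuration. -/
structure IsComputationRecord (L : List Γ) (G : LGraph (labelDim K)) : Prop where
  locallyValid : ∀ v, ∃ t, LocallyValid M S code k₀ t (slots K (G.label v))
    (slots K (∑ w ∈ G.neigh v, G.label w))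
  present : ∑ v, slots K (G.label v) none .present = 1
  input : base Γ ^ L.length * ∑ v, slots K (G.label v) none (.stack k₀) =
    stackNum L * ∑ v, slots K (G.label v) none .scale

theorem IsComputationRecord.eval_dom (hM : TM2.Supports M S) (hcode : Separates S code)
    {L : List Γ} (hG : IsComputationRecord M S code k₀ L G) :
    (eval (TM2.step M) (TM2.init k₀ L)).Dom := by
  choose sl hsl using hG.locallyValid
  obtain ⟨v, hv, hsum⟩ := exists_sum_slot_eq (fun v => (hsl v).eq_zero) (fun v => (hsl v).present)
    hG.present
  have hinput := hG.input
  rw [hsum, hsum] at hinput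
  obtain ⟨hscale, hrep⟩ := (represents_init_iff k₀ L).2 ⟨hv ▸ (hsl v).initial hv, hinput⟩
  rw [← hv] at hscale hrep
  exact eval_dom_of_represents hM hcode (fun w => (hsl w).fuel_nonneg)
    (LocallyValid.isHalted_or_exists_isSuccessor hsl) (Finset.some_mem_insertNone.2 hM.1) hrep
    (zero_lt_one.trans_le hscale)

end LocalValidity

/-! ### Path graphs -/

section PathGraph

variable {K : Type*} [Fintype K]

/-- The slot of the `i`-th record of a computation. -/
def slotAt (i : ℕ) : Slot := Slot.next^[i] none

theorem slotAt_succ (i : ℕ) : slotAt (i + 1) = (slotAt i).next := Function.iterate_succ_apply' ..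

theorem slotAt_eq_none_iff {i : ℕ} : slotAt i = none ↔ i = 0 := by
  cases i with
  | zero => simp [slotAt]
  | succ i => simpa [slotAt_succ] using Slot.next_ne_none _

theorem slotAt_add_two_ne (i : ℕ) : slotAt (i + 2) ≠ slotAt i := by
  rw [slotAt_succ, slotAt_succ]
  exact Slot.next_next_ne _

/-- The path with the nodes `0, …, n`, of which the node `i` holds the record `x i`. -/
noncomputable abbrev pathGraph (n : ℕ) (x : ℕ → Register K → ℕ) : LGraph (labelDim K) where
  V := Fin (n + 1)
  Adj v w := (v : ℕ) + 1 = w ∨ (w : ℕ) + 1 = v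
  symm _ _ := Or.symm
  label v := (slots K).symm (Pi.single (slotAt v) fun r => (x v r : ℝ))

variable {n : ℕ} {x : ℕ → Register K → ℕ}

theorem slots_label_pathGraph (v : Fin (n + 1)) :
    slots K ((pathGraph n x).label v) = Pi.single (slotAt v) fun r => (x v r : ℝ) :=
  LinearEquiv.apply_symm_apply _ _

theorem mem_neigh_pathGraph {v w : Fin (n + 1)} :
    w ∈ (pathGraph n x).neigh v ↔ (v : ℕ) + 1 = w ∨ (w : ℕ) + 1 = v := by
  simp [LGraph.neigh, pathGraph]

theorem degreeLE_pathGraph : (pathGraph n x).DegreeLE 2 := by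
  intro (v : Fin (n + 1))
  rw [← Finset.card_map Fin.valEmbedding]
  refine (Finset.card_le_card fun i hi => ?_).trans
    (Finset.card_le_two (a := (v : ℕ) - 1) (b := v + 1))
  obtain ⟨w, hw, rfl⟩ := Finset.mem_map.1 hi
  rw [mem_neigh_pathGraph] at hw
  simp only [Fin.valEmbedding_apply, Finset.mem_insert, Finset.mem_singleton]
  lia

theorem natLabelled_pathGraph : (pathGraph n x).NatLabelled := by
  intro v i
  obtain ⟨⟨t, r⟩, rfl⟩ := (Fintype.equivFin (Slot × Register K)).surjective i
  change ∃ k : ℕ, slots K ((pathGraph n x).label v) t r = k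
  rw [slots_label_pathGraph]
  rcases eq_or_ne t (slotAt v) with rfl | h
  · exact ⟨x v r, by rw [Pi.single_eq_same]⟩
  · exact ⟨0, by rw [Pi.single_eq_of_ne h]; simp⟩

theorem slots_sum_neigh_pathGraph {v w : Fin (n + 1)} (hvw : (v : ℕ) + 1 = w) (r : Register K) :
    slots K (∑ u ∈ (pathGraph n x).neigh v, (pathGraph n x).label u) (slotAt w) r = x w r := by
  rw [map_sum, Finset.sum_apply, Finset.sum_apply, Finset.sum_eq_single w]
  · rw [slots_label_pathGraph, Pi.single_eq_same]
  · intro u hu huw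
    have huv : (u : ℕ) + 1 = v :=
      (mem_neigh_pathGraph.1 hu).resolve_left fun h => huw (Fin.ext (h.symm.trans hvw))
    have hslot : slotAt w ≠ slotAt u := by
      rw [← hvw, ← huv]
      exact slotAt_add_two_ne _
    rw [slots_label_pathGraph, Pi.single_eq_of_ne hslot, Pi.zero_apply]
  · exact fun h => absurd (mem_neigh_pathGraph.2 (.inl hvw)) h

theorem sum_slots_none_pathGraph (r : Register K) :
    ∑ v, slots K ((pathGraph n x).label v) none r = x 0 r := by
  rw [Finset.sum_eq_single (0 : Fin (n + 1))]
  · have hslot : slotAt ((0 : Fin (n + 1)) : ℕ) = none := rfl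
    rw [slots_label_pathGraph, hslot, Pi.single_eq_same, Fin.val_zero]
  · intro v _ hv
    have hslot : none ≠ slotAt v := fun h => hv (Fin.ext (slotAt_eq_none_iff.1 h.symm))
    rw [slots_label_pathGraph, Pi.single_eq_of_ne hslot, Pi.zero_apply]
  · exact fun h => absurd (Finset.mem_univ _) h

end PathGraph

section Completeness

theorem exists_run {α : Type*} {f : α → Option α} {a : α} (h : (eval f a).Dom) :
    ∃ (n : ℕ) (s : ℕ → α), s 0 = a ∧ (∀ i < n, s (i + 1) ∈ f (s i)) ∧ f (s n) = none := by
  obtain ⟨b, hb⟩ := Part.dom_iff_mem.1 h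
  refine evalInduction hb fun a _ ih => ?_
  cases ha : f a with
  | none => exact ⟨0, fun _ => a, rfl, by simp, ha⟩
  | some a' =>
    obtain ⟨n, s, hs₀, hs, hn⟩ := ih a' ha
    refine ⟨n + 1, fun i => i.casesOn a s, rfl, fun i hi => ?_, hn⟩
    cases i with
    | zero => exact ha.trans (congrArg some hs₀.symm)
    | succ i => exact hs i (Nat.lt_of_succ_lt_succ hi)

variable {K Γ Λ σ : Type*} [Fintype Γ]

/-- The record of the configuration `c`, whose stacks have height at most `h`. -/
noncomputable def record (code : Option Λ × σ → ℕ) (h fuel : ℕ)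
    (c : TM2.Cfg (fun _ : K => Γ) Λ σ) : Register K → ℕ
  | .present => 1
  | .fuel => fuel
  | .state => code (c.l, c.var)
  | .scale => base Γ ^ h
  | .stack k => base Γ ^ (h - (c.stk k).length) * stackNum (c.stk k)

variable {M : Λ → TM2.Stmt (fun _ : K => Γ) Λ σ} {S : Finset Λ} {code : Option Λ × σ → ℕ} {k₀ : K}

theorem represents_record {c : TM2.Cfg (fun _ : K => Γ) Λ σ} {h : ℕ}
    (hc : ∀ k, (c.stk k).length ≤ h) (fuel : ℕ) :
    Represents code (fun r => record code h fuel c r) c := by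
  refine ⟨rfl, fun k => ?_⟩
  simp only [record]
  rw [← base_pow_mul_stackVal (hc k), Nat.cast_pow]

variable [Fintype K] [DecidableEq K] [Inhabited Λ] [Inhabited σ]

theorem locallyValid_pathGraph {n : ℕ} {x : ℕ → Register K → ℕ} (hpresent : ∀ i, x i .present = 1)
    (hinitial : IsInitial code k₀ fun r => x 0 r)
    (hstep : ∀ i < n, IsSuccessor M S code (fun r => x i r) fun r => x (i + 1) r)
    (hhalted : IsHalted code fun r => x n r) (v : Fin (n + 1)) :
    LocallyValid M S code k₀ (slotAt v) (slots K ((pathGraph n x).label v))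
      (slots K (∑ w ∈ (pathGraph n x).neigh v, (pathGraph n x).label w)) := by
  rw [slots_label_pathGraph]
  constructor <;> try simp only [Pi.single_eq_same]
  · exact fun s hs r => by rw [Pi.single_eq_of_ne hs, Pi.zero_apply]
  · rw [hpresent, Nat.cast_one]
  · exact Nat.cast_nonneg _
  · intro hv
    rwa [slotAt_eq_none_iff.1 hv]
  · rcases v.is_le.eq_or_lt with hv | hv
    · exact .inl (hv.symm ▸ hhalted)
    · refine .inr ?_
      have hnb : slots K (∑ w ∈ (pathGraph n x).neigh v, (pathGraph n x).label w)
          (slotAt v).next = fun r => (x (v + 1) r : ℝ) := by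
        rw [← slotAt_succ]
        exact funext (slots_sum_neigh_pathGraph (w := ⟨v + 1, Nat.succ_lt_succ hv⟩) rfl)
      rw [hnb]
      exact ⟨by simp only [hpresent, Nat.cast_one], hstep v hv⟩

theorem exists_isComputationRecord [Nonempty Γ] (hM : TM2.Supports M S) (hcode : Separates S code)
    {L : List Γ} (h : (eval (TM2.step M) (TM2.init k₀ L)).Dom) :
    ∃ G, G.DegreeLE 2 ∧ G.NatLabelled ∧ IsComputationRecord M S code k₀ L G := by
  obtain ⟨n, s, hs₀, hs, hn⟩ := exists_run h
  obtain ⟨h, hh⟩ : ∃ h, ∀ i ≤ n, ∀ k, ((s i).stk k).length ≤ h := by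
    refine ⟨(Finset.range (n + 1) ×ˢ Finset.univ).sup fun p => ((s p.1).stk p.2).length,
      fun i hi k => ?_⟩
    exact Finset.le_sup (f := fun p : ℕ × K => ((s p.1).stk p.2).length) (b := (i, k))
      (by simpa [Nat.lt_succ_iff] using hi)
  have hsupp : ∀ i ≤ n, (s i).l ∈ Finset.insertNone S := by
    intro i
    induction i with
    | zero => exact fun _ => hs₀ ▸ Finset.some_mem_insertNone.2 hM.1
    | succ i ih => exact fun hi => TM2.step_supports M hM (hs i hi) (ih (Nat.le_of_succ_le hi))
  let x (i : ℕ) : Register K → ℕ := record code h (n - i) (s i)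
  have hx (i : ℕ) (hi : i ≤ n) : Represents code (fun r => x i r) (s i) :=
    represents_record (hh i hi) _
  have hscale : 1 ≤ base Γ ^ h := Nat.one_le_pow _ _ (base_pos (Classical.arbitrary Γ))
  have hinit := (represents_init_iff k₀ L).1 ⟨Nat.one_le_cast.2 hscale, hs₀ ▸ hx 0 (Nat.zero_le n)⟩
  refine ⟨pathGraph n x, degreeLE_pathGraph, natLabelled_pathGraph, fun v => ⟨_,
    locallyValid_pathGraph (fun _ => rfl) hinit.1 (fun i hi => ?_) ?_ v⟩, ?_, ?_⟩
  · refine ((hx i hi.le).isSuccessor_iff hcode (hsupp i hi.le) (Nat.cast_pos.2 hscale)).2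
      ⟨?_, rfl, _, hs i hi, hx (i + 1) hi⟩
    simp only [x, record]
    exact_mod_cast (by lia : n - (i + 1) + 1 ≤ n - i)
  · exact ((hx n le_rfl).isHalted_iff hcode (hsupp n le_rfl)).2 hn
  · rw [sum_slots_none_pathGraph]
    exact Nat.cast_one
  · rw [sum_slots_none_pathGraph, sum_slots_none_pathGraph]
    exact hinit.2

end Completeness

/-! ### Networks that recognise records of computations -/

section Networks

/-- A network that computes `max(0, x₀) + |x₁ - 1| + |a x₂ - b x₃|`. -/
def readout (a b : ℕ) : NN 4 1 :=
  .cons ⟨!![1, 0, 0, 0; 0, 1, 0, 0; 0, -1, 0, 0; 0, 0, a, -b; 0, 0, -a, b], ![0, -1, 1, 0, 0]⟩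
    (.last ⟨fun _ _ => 1, 0⟩)

/-- The MPNN with the combination network `comb` of a single layer and a readout network that tests
the sums over all nodes of the violation of the local condition (`x₀`) and of the presence (`x₁`),
the input (`x₂`) and the scale (`x₃`) in the initial configuration. -/
def recordMPNN {d : ℕ} (comb : NN (d + d) 4) (a b : ℕ) : GraphMPNN d 1 :=
  ⟨4, .last comb, readout a b⟩

theorem eval_readout (a b : ℕ) (x : Fin 4 → ℝ) :
    (readout a b).eval x 0 = max 0 (x 0) + |x 1 - 1| + |a * x 2 - b * x 3| := by
  have habs (u : ℝ) : max 0 u + max 0 (-u) = |u| := by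
    rw [max_comm, max_comm 0, max_zero_add_max_neg_zero_eq_abs_self]
  have heval : (readout a b).eval x 0 =
      max 0 (max 0 (x 0) + (max 0 (x 1 - 1) + max 0 (-(x 1 - 1))) +
        (max 0 (a * x 2 - b * x 3) + max 0 (-(a * x 2 - b * x 3)))) := by
    simp [readout, NN.eval, ReLULayer.eval, Fin.sum_univ_succ, sub_eq_add_neg, add_assoc, add_comm]
  rw [heval, habs, habs, max_eq_right (by positivity)]

theorem eval_readout_eq_zero_iff {a b : ℕ} {x : Fin 4 → ℝ} (hx : 0 ≤ x 0) :
    (readout a b).eval x 0 = 0 ↔ x 0 = 0 ∧ x 1 = 1 ∧ a * x 2 = b * x 3 := by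
  rw [eval_readout, max_eq_right hx, add_eq_zero_iff_of_nonneg (by positivity) (abs_nonneg _),
    add_eq_zero_iff_of_nonneg hx (abs_nonneg _), abs_eq_zero, abs_eq_zero, sub_eq_zero, sub_eq_zero,
    and_assoc]

variable {K Γ Λ σ : Type*} [DecidableEq K] [Fintype Γ] [Inhabited Λ] [Inhabited σ]
  {M : Λ → TM2.Stmt (fun _ : K => Γ) Λ σ} {S : Finset Λ} {code : Option Λ × σ → ℕ} {k₀ : K}

/-- The registers of the initial configuration that enter the readout network. -/
def rootRegister (k₀ : K) : Fin 3 → Register K := ![.present, .stack k₀, .scale]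

theorem LocallyValid.rootRegister_nonneg {t : Slot} {own nb : Slot → Register K → ℝ}
    (h : LocallyValid M S code k₀ t own nb) (j : Fin 3) : 0 ≤ own none (rootRegister k₀ j) := by
  rcases eq_or_ne none t with rfl | ht
  · obtain ⟨-, hscale, hinput, -⟩ := h.initial rfl
    fin_cases j
    · exact h.present ▸ zero_le_one
    · exact hinput
    · exact zero_le_one.trans hscale
  · exact (h.eq_zero _ ht _).ge

variable [Fintype K]

variable (M S code k₀) in
theorem exists_NN_eval_append [Finite σ] : ∃ comb : NN (labelDim K + labelDim K) 4,
    ∀ own nb : Fin (labelDim K) → ℝ,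
      (comb.eval (Fin.append own nb) 0 = 0 ↔
        ∃ t, LocallyValid M S code k₀ t (slots K own) (slots K nb)) ∧
      ∀ j : Fin 3, comb.eval (Fin.append own nb) j.succ =
        max 0 (slots K own none (rootRegister k₀ j)) := by
  obtain ⟨comb, hcomb, hroot⟩ := IsPLPred.exists_NN
    (.exists fun t => IsPLPred.locallyValid (M := M) (S := S) (code := code) (k₀ := k₀)
      (own := fun z => slots K fun i => z (Fin.castAdd (labelDim K) i))
      (nb := fun z => slots K fun i => z (Fin.natAdd (labelDim K) i))
      (fun _ _ => .coord _) (fun _ _ => .coord _) t)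
    (g := fun j z => slots K (fun i => z (Fin.castAdd (labelDim K) i)) none (rootRegister k₀ j))
    fun _ => .coord _
  refine ⟨comb, fun own nb => ⟨?_, fun j => ?_⟩⟩
  · simp only [hcomb, Fin.append_left, Fin.append_right]
  · simp only [hroot, Fin.append_left]

variable (M S code k₀) in
theorem exists_eval_eq_zero_iff_isComputationRecord [Finite σ] :
    ∃ comb : NN (labelDim K + labelDim K) 4, ∀ (L : List Γ) (G : LGraph (labelDim K)),
      (recordMPNN comb (base Γ ^ L.length) (stackNum L)).eval G 0 = 0 ↔
        IsComputationRecord M S code k₀ L G := by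
  obtain ⟨comb, hcomb⟩ := exists_NN_eval_append M S code k₀
  refine ⟨comb, fun L G => ?_⟩
  let out (v : G.V) : Fin 4 → ℝ := comb.eval (Fin.append (G.label v) (∑ w ∈ G.neigh v, G.label w))
  have hnonneg (v : G.V) : 0 ≤ out v 0 := NN.eval_nonneg _ _ _
  have hvalid : ∑ v, out v 0 = 0 ↔ ∀ v, ∃ t, LocallyValid M S code k₀ t
      (slots K (G.label v)) (slots K (∑ w ∈ G.neigh v, G.label w)) := by
    simp only [Finset.sum_eq_zero_iff_of_nonneg fun v _ => hnonneg v, Finset.mem_univ,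
      true_imp_iff, out, (hcomb _ _).1]
  have hregister (h : ∑ v, out v 0 = 0) (j : Fin 3) :
      ∑ v, out v j.succ = ∑ v, slots K (G.label v) none (rootRegister k₀ j) := by
    refine Finset.sum_congr rfl fun v _ => ?_
    obtain ⟨t, ht⟩ := hvalid.1 h v
    exact ((hcomb _ _).2 j).trans (max_eq_right (ht.rootRegister_nonneg j))
  have heval : (recordMPNN comb (base Γ ^ L.length) (stackNum L)).eval G =
    (readout (base Γ ^ L.length) (stackNum L)).eval (∑ v, out v) := rfl
  have hsum : 0 ≤ (∑ v, out v) 0 := by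
    rw [Finset.sum_apply]
    exact Finset.sum_nonneg fun v _ => hnonneg v
  have hrecord : IsComputationRecord M S code k₀ L G ↔ ∑ v, out v 0 = 0 ∧
      ∑ v, slots K (G.label v) none (rootRegister k₀ 0) = 1 ∧
      base Γ ^ L.length * ∑ v, slots K (G.label v) none (rootRegister k₀ 1) =
        stackNum L * ∑ v, slots K (G.label v) none (rootRegister k₀ 2) := by
    rw [hvalid]
    exact ⟨fun h => ⟨h.1, h.2, h.3⟩, fun h => ⟨h.1, h.2.1, h.2.2⟩⟩
  rw [heval, eval_readout_eq_zero_iff hsum, hrecord]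
  simp only [Finset.sum_apply, Nat.cast_pow]
  refine and_congr_right fun h => ?_
  rw [← hregister h, ← hregister h, ← hregister h]
  rfl

variable (M k₀) in
theorem exists_halting_network [Nonempty Γ] [Finite σ] (hM : TM2.Supports M S) :
    ∃ comb : NN (labelDim K + labelDim K) 4, ∀ L : List Γ,
      (∀ G, (recordMPNN comb (base Γ ^ L.length) (stackNum L)).eval G 0 = 0 →
        (eval (TM2.step M) (TM2.init k₀ L)).Dom) ∧
      ((eval (TM2.step M) (TM2.init k₀ L)).Dom → ∃ G, G.DegreeLE 2 ∧ G.NatLabelled ∧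
        (recordMPNN comb (base Γ ^ L.length) (stackNum L)).eval G 0 = 0) := by
  obtain ⟨code, hcode⟩ := exists_separates (σ := σ) S
  obtain ⟨comb, hcomb⟩ := exists_eval_eq_zero_iff_isComputationRecord M S code k₀
  refine ⟨comb, fun L => ?_⟩
  simp only [hcomb]
  exact ⟨fun _ hG => hG.eval_dom hM hcode, exists_isComputationRecord hM hcode⟩

end Networks

/-! ### Computable descriptions -/

section Computability

theorem primrec_of_div2 {α : Type*} [Primcodable α] {f : ℕ → α} {g : Bool × α → α} (hg : Primrec g)
    (h : ∀ n ≠ 0, f n = g (n.bodd, f n.div2)) : Primrec f := by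
  let step (l : List α) : Option α :=
    if l.length = 0 then some (f 0) else
      l[l.length.div2]?.map fun a => g (l.length.bodd, a)
  have hlen : Primrec (List.length : List α → ℕ) := .list_length
  have hstep : Primrec step :=
    .ite (Primrec.eq.comp hlen (.const 0)) (.const _) <| .option_map
      (Primrec.list_getElem?.comp .id (Primrec.nat_div2.comp hlen))
      (hg.comp (((Primrec.nat_bodd.comp hlen).comp .fst).pair .snd)).to₂
  refine (Primrec.nat_strong_rec (fun (_ : Unit) => f) (g := fun _ => step)
    (hstep.comp .snd).to₂ fun _ n => ?_).comp (.const ()) .id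
  rcases eq_or_ne n 0 with rfl | hn
  · simp [step]
  · have hlt : n.div2 < n := by
      rw [Nat.div2_val]
      lia
    simp [step, hn, hlt, h n hn]

theorem primrec_code {α : Type*} [Primcodable α] {m n : ℕ} {l : α → ReLULayer m n}
    (hweight : ∀ i j, Primrec fun a => ratCode ((l a).weight i j))
    (hbias : ∀ i, Primrec fun a => ratCode ((l a).bias i)) : Primrec fun a => (l a).code :=
  .list_ofFn fun i => .pair (.list_ofFn (hweight i)) (hbias i)

theorem primrec_ratCode_natCast : Primrec fun n : ℕ => ratCode n := by
  have hcode (n : ℕ) : ratCode n = (false, n, 1) := by simp [ratCode]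
  simp only [hcode]
  exact .pair (.const _) (.pair .id (.const _))

theorem primrec_ratCode_neg_natCast : Primrec fun n : ℕ => ratCode (-n) := by
  have hcode (n : ℕ) : ratCode (-n) = (decide (0 < n), n, 1) := by simp [ratCode]
  simp only [hcode]
  exact .pair (Primrec.nat_lt.comp (.const 0) .id).decide (.pair .id (.const _))

theorem primrec_readout_code {α : Type*} [Primcodable α] {a b : α → ℕ} (ha : Primrec a)
    (hb : Primrec b) : Primrec fun x => (readout (a x) (b x)).code := by
  have ha' := primrec_ratCode_natCast.comp ha
  have hb' := primrec_ratCode_natCast.comp hb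
  have hna := primrec_ratCode_neg_natCast.comp ha
  have hnb := primrec_ratCode_neg_natCast.comp hb
  have hconst (q : ℚ) : Primrec fun _ : α => ratCode q := .const _
  refine .pair (.const 4) (Primrec.list_cons.comp
    (primrec_code (fun i j => ?_) fun i => hconst (![0, -1, 1, 0, 0] i))
    (.const [ReLULayer.code ⟨fun _ _ => 1, 0⟩]))
  fin_cases i <;> fin_cases j <;>
    first | assumption | exact hconst 0 | exact hconst 1 | exact hconst (-1)

open PartrecToTM2

theorem trNat_eq_cons {n : ℕ} (hn : n ≠ 0) :
    trNat n = (if n.bodd then Γ'.bit1 else Γ'.bit0) :: trNat n.div2 := by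
  have hn0 : (n : Num) ≠ 0 := by simpa only [ne_eq, Nat.cast_eq_zero]
  have hbit := Num.ofNat'_bit n.bodd n.div2
  rw [Nat.bit_bodd_div2, Num.ofNat'_eq, Num.ofNat'_eq] at hbit
  rw [trNat, trNat]
  rw [hbit] at hn0 ⊢
  revert hn0
  cases n.bodd <;> cases (n.div2 : Num)
  · exact fun h => (h rfl).elim
  all_goals exact fun _ => rfl

/-- The measures of a stack that enter the readout network. -/
noncomputable def stackCode {Γ : Type*} [Fintype Γ] (L : List Γ) : ℕ × ℕ :=
  (base Γ ^ L.length, stackNum L)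

theorem primrec_stackCode_trList : Primrec fun n => stackCode (trList [n]) := by
  let push (p : Bool × ℕ × ℕ) : ℕ × ℕ := (base Γ' * p.2.1,
    (if p.1 then digit Γ'.bit1 else digit Γ'.bit0) * p.2.1 + p.2.2)
  have hsize : Primrec fun p : Bool × ℕ × ℕ => p.2.1 := .comp .fst .snd
  have hdigit : Primrec fun p : Bool × ℕ × ℕ =>
      if p.1 then digit Γ'.bit1 else digit Γ'.bit0 :=
    .ite (Primrec.eq.comp .fst (.const true)) (.const _) (.const _)
  have hpush : Primrec push := .pair (Primrec.nat_mul.comp (.const _) hsize)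
    (Primrec.nat_add.comp (Primrec.nat_mul.comp hdigit hsize) (.comp .snd .snd))
  refine primrec_of_div2 hpush fun n hn => ?_
  simp only [trList, trNat_eq_cons hn, List.cons_append, stackCode, stackNum, push,
    List.length_cons, pow_succ', apply_ite digit]

instance : Fintype K' := ⟨{.main, .rev, .aux, .stack}, by rintro ⟨⟩ <;> decide⟩

theorem exists_halting_networks {f : ℕ →. ℕ} (hf : Partrec f) :
    ∃ (d : ℕ) (comb : NN (d + d) 4) (a b : ℕ → ℕ), Primrec a ∧ Primrec b ∧ ∀ n,
      (∀ G, (recordMPNN comb (a n) (b n)).eval G 0 = 0 → (f n).Dom) ∧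
      ((f n).Dom → ∃ G, G.DegreeLE 2 ∧ G.NatLabelled ∧
        (recordMPNN comb (a n) (b n)).eval G 0 = 0) := by
  obtain ⟨c, hc⟩ := ToPartrec.Code.exists_code (Nat.Partrec'.part_iff₁.2 hf)
  let _ : Inhabited Λ' := ⟨trNormal c .halt⟩
  have hdom (n : ℕ) :
      (StateTransition.eval (TM2.step tr) (TM2.init K'.main (trList [n]))).Dom ↔ (f n).Dom := by
    have hinit : TM2.init K'.main (trList [n]) = PartrecToTM2.init c [n] := by
      simp only [TM2.init, PartrecToTM2.init]
      congr 1
      ext k : 1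
      cases k <;> rfl
    rw [hinit, PartrecToTM2.tr_eval, show [n] = (n ::ᵥ .nil).1 from rfl, hc]
    rfl
  obtain ⟨comb, hcomb⟩ := exists_halting_network tr K'.main (tr_supports c .halt)
  refine ⟨_, comb, fun n => (stackCode (trList [n])).1, fun n => (stackCode (trList [n])).2,
    Primrec.fst.comp primrec_stackCode_trList, Primrec.snd.comp primrec_stackCode_trList,
    fun n => ?_⟩
  rw [← hdom]
  exact hcomb (trList [n])

end Computability

theorem theorem1_general {Φ : Type u} [Primcodable Φ] (sat : Φ → ∀ n : ℕ, LGraph n → Prop)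
    (hΦ : ∃ φ, ∀ (n : ℕ) (G : LGraph n), G.DegreeLE 2 → G.NatLabelled → sat φ n G) :
    ¬ FormallyVerifiable (ORPGraph.code (Φ := Φ)) (ORPGraph.Holds sat) := by
  rintro ⟨A, hA, hdec⟩
  obtain ⟨φ, hφ⟩ := hΦ
  have hf : Partrec fun n : ℕ => (Denumerable.ofNat Nat.Partrec.Code n).eval 0 :=
    Nat.Partrec.Code.eval_part.comp (Computable.ofNat _) (.const 0)
  obtain ⟨d, comb, a, b, ha, hb, hcomb⟩ := exists_halting_networks hf
  let Q (n : ℕ) : ORPGraph Φ := ⟨d, 1, recordMPNN comb (a n) (b n), φ, ⟨0, 0⟩⟩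
  have hQ (n : ℕ) : (Q n).Holds sat ↔
      ((Denumerable.ofNat Nat.Partrec.Code n).eval 0).Dom := by
    have hsat (y : Fin 1 → ℝ) : (⟨0, 0⟩ : EqSpec 1).Sat y ↔ y 0 = 0 := by simp [EqSpec.Sat]
    refine ⟨fun ⟨G, _, hG⟩ => (hcomb n).1 G ((hsat _).1 hG), fun h => ?_⟩
    obtain ⟨G, hdeg, hnat, hG⟩ := (hcomb n).2 h
    exact ⟨G, hφ d G hdeg hnat, (hsat _).2 hG⟩
  have hcode : Primrec fun n => (Q n).code :=
    ((Primrec.const [comb.code]).pair (primrec_readout_code ha hb)).pair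
      (.const (φ, (0, ratCode 0)))
  choose r hr hrQ using fun n => hdec (Q n)
  have hcomp : Computable r := Partrec.of_eq_tot (hA.comp hcode.to_comp) hr
  refine ComputablePred.halting_problem 0 (ComputablePred.computable_iff.2
    ⟨fun e => r (Encodable.encode e), hcomp.comp .encode, ?_⟩)
  ext e
  rw [hrQ, hQ, Denumerable.ofNat_encode]

theorem theorem1 {Φ : Type u} [Primcodable Φ] (sat : Φ → ∀ n : ℕ, LGraph n → Prop)
    (hΦ : ContainsUnbounded sat) :
    ¬ FormallyVerifiable (ORPGraph.code (Φ := Φ)) (ORPGraph.Holds sat) :=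
  theorem1_general sat (hΦ.imp fun _ h n G hG => h n G fun v => (hG v).trans (by norm_num))
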